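/- Let $N\ge 2$ and $n$ be natural numbers, let $\sigma$ be a permutation of $\{1,\dots,n\}$ and let $z_1,\dots,z_n$ be complex numbers of modulus one with $z_i^N=z_{\sigma(i)}$ for all $i$. On the Hilbert space $L^2(\mathbb{R})^n$ (the direct sum of $n$ copies of $L^2(\mathbb R)$) consider the unitary operators $$T(f_1,\dots,f_n)=(z_1T_0f_1,\dots,z_nT_0f_n),\qquad U(f_1,\dots,f_n)=(U_0f_{\sigma(1)},\dots,U_0f_{\sigma(n)}),$$ where $T_0f(x)=f(x-1)$ and $U_0f(x)=N^{-1/2}f(x/N)$. Let $(V_j)_{j\in\mathbb{Z}}$ be a generalized multiresolution analysis (GMRA), i.e. a family of linear subspaces of $L^2(\mathbb{R})^n$ with $V_j\subseteq V_{j+1}$ and $UV_j=V_{j-1}$ for all $j\in\mathbb{Z}$, with $\bigcup_jV_j$ dense in $L^2(\mathbb{R})^n$ and $\bigcap_jV_j=\{0\}$, and with $T^kV_0\subseteq V_0$ for all $k\in\mathbb{Z}$. Let $\Phi\subseteq V_0$ be a normalized tight frame (NTF) generator for $V_0$, i.e. $\sum_{\varphi\in\Phi}\sum_{k\in\mathbb{Z}}|\langle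 f,T^k\varphi\rangle|^2=\|f\|^2$ for all $f\in V_0$. Write $\varphi=(\varphi_1,\dots,\varphi_n)$ for $\varphi\in\Phi$, and let $\widehat{f}$ be the $L^2$ Fourier transform of $f\in L^2(\mathbb R)$ in the normalization $\widehat{f}(\xi)=\int_{\mathbb{R}}f(x)e^{-i\xi x}\,dx$. Then, for almost every $\xi\in\mathbb{R}$ and every $i\in\{1,\dots,n\}$, the sums $\sum_{\varphi\in\Phi}|\widehat{\varphi}_i|^2(\xi/N^m)$ are finite for all integers $m\ge 0$, and $$\lim_{m\to\infty}\sum_{\varphi\in\Phi}|\widehat{\varphi}_i|^2\left(\frac{\xi}{N^m}\right)=1.$$ -/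

import Mathlib

open MeasureTheory Filter Topology
open scoped FourierTransform SchwartzMap ENNReal

noncomputable section

namespace SuperWavelet

/-- The Hilbert space `L²(ℝ)` of complex-valued functions. -/
abbrev L2R : Type := Lp ℂ 2 (volume : Measure ℝ)

/-- The Hilbert space `L²(ℝ)ⁿ = L²(ℝ) ⊕ ... ⊕ L²(ℝ)` (`n` summands). -/
abbrev L2Rn (n : ℕ) : Type := PiLp 2 (fun _ : Fin n => L2R)

/-- The translation `(T₀ f)(x) = f (x - 1)` as a unitary operator of `L²(ℝ)`. -/
def T₀ : L2R ≃ₗᵢ[ℂ] L2R :=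
  LinearIsometryEquiv.ofSurjective
    (Lp.compMeasurePreservingₗᵢ ℂ (fun x : ℝ => x - 1) (measurePreserving_sub_right volume 1))
    (fun g => by
      refine ⟨Lp.compMeasurePreserving (fun x : ℝ => x + 1)
        (measurePreserving_add_right volume 1) g, ?_⟩
      apply Lp.ext
      have h1 := Lp.coeFn_compMeasurePreserving
        (Lp.compMeasurePreserving (fun x : ℝ => x + 1)
          (measurePreserving_add_right volume 1) g) (measurePreserving_sub_right volume (1 : ℝ))
      have h2 := (measurePreserving_sub_right volume (1 : ℝ)).quasiMeasurePreserving.ae_eq_comp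
        (Lp.coeFn_compMeasurePreserving g (measurePreserving_add_right volume (1 : ℝ)))
      refine h1.trans (h2.trans (Eventually.of_forall fun x => ?_))
      simp)

theorem T₀_coe (f : L2R) : T₀ f =ᵐ[volume] fun x : ℝ => f (x - 1) :=
  Lp.coeFn_compMeasurePreserving f (measurePreserving_sub_right volume (1 : ℝ))

theorem quasiMP_div {c : ℝ} (hc : 0 < c) :
    Measure.QuasiMeasurePreserving (fun x : ℝ => x / c) volume volume := by
  refine ⟨by fun_prop, ?_⟩
  have h := Real.map_volume_mul_right (a := c⁻¹) (inv_ne_zero hc.ne')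
  simp only [div_eq_mul_inv]
  rw [h]
  exact Measure.smul_absolutelyContinuous

theorem eLpNorm_dil {c : ℝ} (hc : 0 < c) (f : L2R) :
    eLpNorm (fun x : ℝ => ((Real.sqrt c)⁻¹ : ℂ) * f (x / c)) 2 volume = eLpNorm f 2 volume := by
  have hm : AEStronglyMeasurable (f : ℝ → ℂ) (Measure.map (fun x : ℝ => x / c) volume) :=
    (Lp.aestronglyMeasurable f).mono_ac (quasiMP_div hc).absolutelyContinuous
  have h1 := eLpNorm_map_measure (p := 2) hm (by fun_prop : AEMeasurable (fun x : ℝ => x / c) volume)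
  have h2 : Measure.map (fun x : ℝ => x / c) volume = ENNReal.ofReal c • volume := by
    have h := Real.map_volume_mul_right (a := c⁻¹) (inv_ne_zero hc.ne')
    simp only [div_eq_mul_inv]
    rw [h, inv_inv, abs_of_pos hc]
  rw [h2, eLpNorm_smul_measure_of_ne_top (by norm_num)] at h1
  have h3 := eLpNorm_const_smul ((Real.sqrt c)⁻¹ : ℂ) ((f : ℝ → ℂ) ∘ fun x : ℝ => x / c) 2
    (volume : Measure ℝ)
  have h4 : (fun x : ℝ => ((Real.sqrt c)⁻¹ : ℂ) * f (x / c))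
      = ((Real.sqrt c)⁻¹ : ℂ) • ((f : ℝ → ℂ) ∘ fun x : ℝ => x / c) := rfl
  rw [h4, h3, ← h1, smul_eq_mul, ← mul_assoc]
  have h5 : ‖((Real.sqrt c)⁻¹ : ℂ)‖ₑ * ENNReal.ofReal c ^ ((1 / 2 : ℝ≥0∞)).toReal = 1 := by
    have e : ‖((Real.sqrt c)⁻¹ : ℂ)‖ₑ = ENNReal.ofReal (Real.sqrt c)⁻¹ := by
      rw [← ofReal_norm, norm_inv, Complex.norm_real, Real.norm_of_nonneg (Real.sqrt_nonneg c)]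
    rw [e, ENNReal.ofReal_rpow_of_pos hc, ← ENNReal.ofReal_mul (by positivity)]
    have : c ^ ((1 / 2 : ℝ≥0∞)).toReal = Real.sqrt c := by
      rw [Real.sqrt_eq_rpow, ENNReal.toReal_div]; norm_num
    rw [this, inv_mul_cancel₀ (Real.sqrt_pos.2 hc).ne', ENNReal.ofReal_one]
  rw [h5, one_mul]

theorem memLp_dil {c : ℝ} (hc : 0 < c) (f : L2R) :
    MemLp (fun x : ℝ => ((Real.sqrt c)⁻¹ : ℂ) * f (x / c)) 2 volume :=
  ⟨((Lp.aestronglyMeasurable f).comp_quasiMeasurePreserving (quasiMP_div hc)).const_mul _,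
    by rw [eLpNorm_dil hc]; exact Lp.eLpNorm_lt_top f⟩

/-- The dilation by `c > 0` as a linear isometry of `L²(ℝ)`: `f ↦ c^{-1/2} f (x / c)`. -/
def dilIsometry {c : ℝ} (hc : 0 < c) : L2R →ₗᵢ[ℂ] L2R where
  toFun f := (memLp_dil hc f).toLp _
  map_add' f g := by
    rw [← MemLp.toLp_add]
    refine MemLp.toLp_congr _ _ ?_
    filter_upwards [(quasiMP_div hc).ae_eq_comp (Lp.coeFn_add f g)] with x hx
    simp only [Function.comp_apply, Pi.add_apply] at hx ⊢
    rw [hx, mul_add]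
  map_smul' a f := by
    rw [RingHom.id_apply, ← MemLp.toLp_const_smul]
    refine MemLp.toLp_congr _ _ ?_
    filter_upwards [(quasiMP_div hc).ae_eq_comp (Lp.coeFn_smul a f)] with x hx
    simp only [Function.comp_apply, Pi.smul_apply, smul_eq_mul] at hx ⊢
    rw [hx]; ring
  norm_map' f := by
    change ‖(memLp_dil hc f).toLp _‖ = ‖f‖
    rw [Lp.norm_toLp, eLpNorm_dil hc, Lp.norm_def]

theorem dilIsometry_coe {c : ℝ} (hc : 0 < c) (f : L2R) :
    dilIsometry hc f =ᵐ[volume] fun x : ℝ => ((Real.sqrt c)⁻¹ : ℂ) * f (x / c) :=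
  (memLp_dil hc f).coeFn_toLp

/-- The dilation `(U₀ f)(x) = N^{-1/2} f (x / N)` as a unitary operator of `L²(ℝ)`. -/
def U₀ (N : ℕ) (hN : 2 ≤ N) : L2R ≃ₗᵢ[ℂ] L2R :=
  have hc : (0 : ℝ) < N := by exact_mod_cast (by omega : 0 < N)
  LinearIsometryEquiv.ofSurjective (dilIsometry hc) (fun g => by
    refine ⟨dilIsometry (inv_pos.2 hc) g, ?_⟩
    apply Lp.ext
    refine (dilIsometry_coe hc _).trans ?_
    filter_upwards [(quasiMP_div hc).ae_eq_comp (dilIsometry_coe (inv_pos.2 hc) g)] with x hx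
    simp only [Function.comp_apply] at hx
    have hs : (Real.sqrt (N : ℝ) : ℂ) ≠ 0 := by
      exact_mod_cast (Real.sqrt_pos.2 hc).ne'
    rw [hx, Real.sqrt_inv, div_inv_eq_mul, div_mul_cancel₀ _ hc.ne']
    push_cast
    rw [inv_inv, ← mul_assoc, inv_mul_cancel₀ hs, one_mul])

theorem U₀_coe (N : ℕ) (hN : 2 ≤ N) (f : L2R) :
    U₀ N hN f =ᵐ[volume] fun x : ℝ => ((Real.sqrt N)⁻¹ : ℂ) * f (x / N) :=
  dilIsometry_coe (c := (N : ℝ)) (by exact_mod_cast (by omega : 0 < N)) f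

/-- Multiplication by a complex number of modulus one, as a unitary operator of `L²(ℝ)`. -/
def phase (z : Circle) : L2R ≃ₗᵢ[ℂ] L2R where
  toLinearEquiv := LinearEquiv.smulOfNeZero ℂ L2R (z : ℂ) z.coe_ne_zero
  norm_map' f := by
    change ‖(z : ℂ) • f‖ = ‖f‖
    rw [norm_smul, Circle.norm_coe, one_mul]

/-- The translation of the permutative wavelet representation,
`T (f₁, ..., fₙ) = (z₁ T₀ f₁, ..., zₙ T₀ fₙ)`. -/
def T {n : ℕ} (z : Fin n → Circle) : L2Rn n ≃ₗᵢ[ℂ] L2Rn n :=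
  LinearIsometryEquiv.piLpCongrRight 2 (fun i => T₀.trans (phase (z i)))

/-- The dilation of the permutative wavelet representation,
`U (f₁, ..., fₙ) = (U₀ f_{σ(1)}, ..., U₀ f_{σ(n)})`. -/
def U {n : ℕ} (N : ℕ) (hN : 2 ≤ N) (σ : Equiv.Perm (Fin n)) : L2Rn n ≃ₗᵢ[ℂ] L2Rn n :=
  (LinearIsometryEquiv.piLpCongrLeft 2 ℂ L2R σ.symm).trans
    (LinearIsometryEquiv.piLpCongrRight 2 (fun _ => U₀ N hN))

theorem T_apply {n : ℕ} (z : Fin n → Circle) (f : L2Rn n) (i : Fin n) :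
    T z f i = (z i : ℂ) • T₀ (f i) := rfl

theorem U_apply {n : ℕ} (N : ℕ) (hN : 2 ≤ N) (σ : Equiv.Perm (Fin n)) (f : L2Rn n) (i : Fin n) :
    U N hN σ f i = U₀ N hN (f (σ i)) := rfl

/-- A subspace of `L²(ℝ)ⁿ` is shift invariant if `T^k V ⊆ V` for all `k ∈ ℤ`. -/
def IsShiftInvariant {n : ℕ} (z : Fin n → Circle) (V : Submodule ℂ (L2Rn n)) : Prop :=
  ∀ k : ℤ, ∀ f ∈ V, (T z ^ k) f ∈ V

/-- Generalized multiresolution analysis of `L²(ℝ)ⁿ` for the affine structure `(U, T)`. -/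
structure IsGMRA {n : ℕ} (N : ℕ) (hN : 2 ≤ N) (σ : Equiv.Perm (Fin n)) (z : Fin n → Circle)
    (V : ℤ → Submodule ℂ (L2Rn n)) : Prop where
  le_succ : ∀ j : ℤ, V j ≤ V (j + 1)
  map_U : ∀ j : ℤ, (V j).map (U N hN σ).toLinearEquiv.toLinearMap = V (j - 1)
  dense_iUnion : Dense (⋃ j : ℤ, (V j : Set (L2Rn n)))
  iInf_eq_bot : ⨅ j : ℤ, V j = ⊥
  shiftInvariant : IsShiftInvariant z (V 0)

/-- A family `(eᵢ)` is a normalized tight frame for the subspace `V` if its members lie in `V`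
and `∑ᵢ |⟨f, eᵢ⟩|² = ‖f‖²` for all `f ∈ V`. -/
def IsNTF {n : ℕ} {ι : Type*} (e : ι → L2Rn n) (V : Submodule ℂ (L2Rn n)) : Prop :=
  (∀ i, e i ∈ V) ∧ ∀ f ∈ V, HasSum (fun i => ‖inner ℂ (e i) f‖ ^ 2) (‖f‖ ^ 2)

/-- A subset `Φ` of `V` is a normalized tight frame generator for the shift invariant subspace `V`
if the family `(T^k φ)`, indexed by the pairs `(k, φ) ∈ ℤ × Φ`, is a normalized tight frame
for `V`. -/
def IsNTFGenerator {n : ℕ} (z : Fin n → Circle) (Φ : Set (L2Rn n))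
    (V : Submodule ℂ (L2Rn n)) : Prop :=
  Φ ⊆ V ∧ IsNTF (fun p : ℤ × Φ => (T z ^ p.1) (p.2 : L2Rn n)) V

/-- The `L²` Fourier transform in the normalization `f̂ (ξ) = ∫ f(x) e^{-iξx} dx`,
obtained by rescaling Mathlib's unitary transform `𝓕 f (ξ) = ∫ f(x) e^{-2πiξx} dx`. -/
def hat (f : L2R) : ℝ → ℂ := fun ξ => (𝓕 f : L2R) (ξ / (2 * Real.pi))

/-- On Schwartz functions `hat` is the integral `∫ f(x) e^{-iξx} dx`. -/
theorem hat_schwartz (f : 𝓢(ℝ, ℂ)) :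
    hat (f.toLp 2) =ᵐ[volume] fun ξ : ℝ => ∫ x : ℝ, f x * Complex.exp (-Complex.I * ξ * x) := by
  have hc : (0 : ℝ) < 2 * Real.pi := by positivity
  have h : (𝓕 (f.toLp 2 volume) : L2R) =ᵐ[volume] (𝓕 f : 𝓢(ℝ, ℂ)) := by
    rw [SchwartzMap.toLp_fourier_eq]
    exact SchwartzMap.coeFn_toLp _ _ _
  filter_upwards [(quasiMP_div hc).ae_eq_comp h] with ξ hξ
  simp only [Function.comp_apply] at hξ
  rw [hat, hξ, SchwartzMap.fourier_coe, Real.fourier_real_eq_integral_exp_smul]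
  refine integral_congr_ae (Eventually.of_forall fun x => ?_)
  simp only [smul_eq_mul]
  rw [mul_comm]
  congr 2
  have hp : (Real.pi : ℂ) ≠ 0 := by exact_mod_cast Real.pi_ne_zero
  push_cast
  field_simp

end SuperWavelet

end


/-!
Write `τᵢ(ξ) = ∑_{φ ∈ Φ} |𝓕 φᵢ (ξ)|²`. The shifts `T^k φ` form a normalized tight frame of `V₀`, so
for every `f` the sum `∑ |⟨f, T^k φ⟩|²` equals `‖f‖² - dist(f, V₀)²`. If the only nonzero component
of `f` is the `i`-th one and its Fourier transform is `1_A` for a set `A` contained in a unit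
interval, then Parseval's identity for Fourier series evaluates the same sum as `∫_A τᵢ`; hence
`τᵢ ≤ 1`.

Applied to `U^j f`, where now only `N^{-j} A` has to lie in a unit interval, the same computation
gives `∫_A τ_{σ^{-j}(i)} (ξ / N^j) dξ = |A| - dist(U^j f, V₀)²`. Since `U` is an isometry mapping
`V₀` into itself and the spaces `U^{-j} V₀` have dense union, the distance decreases to `0`. Thus
`τ_{σ^{-j}(i)} (ξ / N^j)` increases to `1` for almost every `ξ`, and the permutation can be removed
because there are only finitely many indices.
-/

noncomputable section

namespace SuperWavelet

section Metric

variable {X : Type*} [PseudoMetricSpace X] {D : X → X} {K : Set X}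

theorem isometry_iterate (hD : Isometry D) (k : ℕ) : Isometry D^[k] :=
  Nat.rec isometry_id (fun _ ih => ih.comp hD) k

theorem antitone_infDist_iterate (hD : Isometry D) (hK : Set.MapsTo D K K) (hne : K.Nonempty)
    (x : X) : Antitone fun j : ℕ => Metric.infDist (D^[j] x) K := by
  refine antitone_nat_of_succ_le fun j => ?_
  rw [Function.iterate_succ_apply', ← Metric.infDist_image hD (x := D^[j] x)]
  exact Metric.infDist_le_infDist_of_subset hK.image_subset (hne.image D)

theorem tendsto_infDist_iterate (hD : Isometry D) (hK : Set.MapsTo D K K)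
    (hdense : Dense {x | ∃ j : ℕ, D^[j] x ∈ K}) (x : X) :
    Tendsto (fun j : ℕ => Metric.infDist (D^[j] x) K) atTop (𝓝 0) := by
  rw [Metric.tendsto_atTop]
  intro ε hε
  obtain ⟨y, ⟨k, hk⟩, hxy⟩ := Metric.mem_closure_iff.1 (hdense x) ε hε
  refine ⟨k, fun j hj => ?_⟩
  rw [Real.dist_0_eq_abs, abs_of_nonneg Metric.infDist_nonneg]
  calc Metric.infDist (D^[j] x) K
      ≤ Metric.infDist (D^[k] x) K := antitone_infDist_iterate hD hK ⟨_, hk⟩ x hj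
    _ ≤ dist (D^[k] x) (D^[k] y) := Metric.infDist_le_dist_of_mem hk
    _ = dist x y := (isometry_iterate hD k).dist_eq x y
    _ < ε := hxy

end Metric

section Frame

variable (𝕜 : Type*) {H ι : Type*} [RCLike 𝕜] [NormedAddCommGroup H] [InnerProductSpace 𝕜 H]

include 𝕜 in
theorem enorm_add_sq_add_enorm_sub_sq (x y : H) :
    ‖x + y‖ₑ ^ 2 + ‖x - y‖ₑ ^ 2 = 2 * (‖x‖ₑ ^ 2 + ‖y‖ₑ ^ 2) := by
  simp only [← ofReal_norm, ← ENNReal.ofReal_pow (norm_nonneg _)]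
  rw [← ENNReal.ofReal_ofNat, ← ENNReal.ofReal_add (by positivity) (by positivity),
    ← ENNReal.ofReal_add (by positivity) (by positivity), ← ENNReal.ofReal_mul (by norm_num)]
  congr 1
  linarith [parallelogram_law_with_norm 𝕜 x y]

/-- The frame energy `∑ᵢ |⟨eᵢ, f⟩|²` of `f` with respect to the family `e`. It takes values in
`[0, ∞]`, so that no summability has to be tracked. -/
def frameEnergy (e : ι → H) (f : H) : ℝ≥0∞ :=
  ∑' i, ‖inner 𝕜 (e i) f‖ₑ ^ 2

variable {𝕜}

theorem frameEnergy_eq_of_hasSum {e : ι → H} {f : H}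
    (h : HasSum (fun i => ‖inner 𝕜 (e i) f‖ ^ 2) (‖f‖ ^ 2)) : frameEnergy 𝕜 e f = ‖f‖ₑ ^ 2 := by
  have hsum := ENNReal.ofReal_tsum_of_nonneg (fun i => sq_nonneg ‖inner 𝕜 (e i) f‖) h.summable
  simp only [h.tsum_eq, ENNReal.ofReal_pow (norm_nonneg _), ofReal_norm] at hsum
  exact hsum.symm

theorem frameEnergy_add_add_frameEnergy_sub (e : ι → H) (f g : H) :
    frameEnergy 𝕜 e (f + g) + frameEnergy 𝕜 e (f - g) =
      2 * (frameEnergy 𝕜 e f + frameEnergy 𝕜 e g) := by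
  simp only [frameEnergy, ← ENNReal.tsum_add, ← ENNReal.tsum_mul_left, inner_add_right,
    inner_sub_right, enorm_add_sq_add_enorm_sub_sq 𝕜]

variable {e : ι → H} {K : Submodule 𝕜 H}

theorem frameEnergy_le_of_mem_closure (h : ∀ f ∈ K, frameEnergy 𝕜 e f ≤ ‖f‖ₑ ^ 2) {f : H}
    (hf : f ∈ K.topologicalClosure) : frameEnergy 𝕜 e f ≤ ‖f‖ₑ ^ 2 := by
  have hfin (s : Finset ι) : ∑ i ∈ s, ‖inner 𝕜 (e i) f‖ₑ ^ 2 ≤ ‖f‖ₑ ^ 2 := by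
    have hclosed : IsClosed {g : H | ∑ i ∈ s, ‖inner 𝕜 (e i) g‖ₑ ^ 2 ≤ ‖g‖ₑ ^ 2} :=
      isClosed_le (by fun_prop) (by fun_prop)
    exact closure_minimal (fun g hg => (ENNReal.sum_le_tsum s).trans (h g hg)) hclosed hf
  rw [frameEnergy, ENNReal.tsum_eq_iSup_sum]
  exact iSup_le hfin

theorem frameEnergy_eq_of_mem_closure (h : ∀ f ∈ K, frameEnergy 𝕜 e f = ‖f‖ₑ ^ 2) {f : H}
    (hf : f ∈ K.topologicalClosure) : frameEnergy 𝕜 e f = ‖f‖ₑ ^ 2 := by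
  have hle {g : H} (hg : g ∈ K.topologicalClosure) : frameEnergy 𝕜 e g ≤ ‖g‖ₑ ^ 2 :=
    frameEnergy_le_of_mem_closure (fun g hg => (h g hg).le) hg
  -- The parallelogram law for `f = u + (f - u)` and `2u - f = u - (f - u)`; then let `u → f`.
  have hsubset : ∀ u ∈ K, 2 * ‖u‖ₑ ^ 2 ≤ frameEnergy 𝕜 e f + ‖u - (f - u)‖ₑ ^ 2 := fun u hu => by
    have hu' := K.le_topologicalClosure hu
    calc 2 * ‖u‖ₑ ^ 2
        = 2 * frameEnergy 𝕜 e u := by rw [h u hu]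
      _ ≤ 2 * (frameEnergy 𝕜 e u + frameEnergy 𝕜 e (f - u)) := by gcongr; exact le_self_add
      _ = frameEnergy 𝕜 e f + frameEnergy 𝕜 e (u - (f - u)) := by
        rw [← frameEnergy_add_add_frameEnergy_sub, add_sub_cancel]
      _ ≤ frameEnergy 𝕜 e f + ‖u - (f - u)‖ₑ ^ 2 := by
        gcongr
        exact hle (sub_mem hu' (sub_mem hf hu'))
  have hclosed : IsClosed {u : H | 2 * ‖u‖ₑ ^ 2 ≤ frameEnergy 𝕜 e f + ‖u - (f - u)‖ₑ ^ 2} :=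
    isClosed_le ((ENNReal.continuous_const_mul (by simp)).comp (by fun_prop)) (by fun_prop)
  have hlim : 2 * ‖f‖ₑ ^ 2 ≤ frameEnergy 𝕜 e f + ‖f - (f - f)‖ₑ ^ 2 :=
    closure_minimal hsubset hclosed hf
  rw [sub_self, sub_zero, two_mul] at hlim
  exact (hle hf).antisymm ((ENNReal.add_le_add_iff_right (by finiteness)).1 hlim)

theorem frameEnergy_eq_sub_infDist_sq [CompleteSpace H] (he : ∀ i, e i ∈ K)
    (h : ∀ f ∈ K, frameEnergy 𝕜 e f = ‖f‖ₑ ^ 2) (f : H) :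
    frameEnergy 𝕜 e f = ENNReal.ofReal (‖f‖ ^ 2 - Metric.infDist f K ^ 2) := by
  set P := K.topologicalClosure.starProjection
  have hP : P f ∈ K.topologicalClosure := Submodule.starProjection_apply_mem _ f
  have horth : ∀ v ∈ K.topologicalClosure, inner 𝕜 v (f - P f) = 0 := fun v hv =>
    inner_eq_zero_symm.1 (Submodule.starProjection_inner_eq_zero f v hv)
  have henergy : frameEnergy 𝕜 e f = frameEnergy 𝕜 e (P f) := tsum_congr fun i => by
    have := horth _ (K.le_topologicalClosure (he i))
    rw [inner_sub_right, sub_eq_zero] at this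
    rw [this]
  have hdist : Metric.infDist f K = ‖f - P f‖ := by
    rw [← Metric.infDist_closure, ← Submodule.topologicalClosure_coe, Metric.infDist_eq_iInf,
      Submodule.starProjection_minimal]
    simp only [dist_eq_norm]
    rfl
  have hpyth : ‖f‖ ^ 2 = ‖P f‖ ^ 2 + ‖f - P f‖ ^ 2 := by
    have := norm_add_sq_eq_norm_sq_add_norm_sq_of_inner_eq_zero (𝕜 := 𝕜) _ _ (horth _ hP)
    simpa only [add_sub_cancel, sq] using this
  rw [henergy, frameEnergy_eq_of_mem_closure h hP, hdist, hpyth, add_sub_cancel_right,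
    ENNReal.ofReal_pow (norm_nonneg _), ofReal_norm]

theorem frameEnergy_le_enorm_sq [CompleteSpace H] (he : ∀ i, e i ∈ K)
    (h : ∀ f ∈ K, frameEnergy 𝕜 e f = ‖f‖ₑ ^ 2) (f : H) : frameEnergy 𝕜 e f ≤ ‖f‖ₑ ^ 2 := by
  rw [frameEnergy_eq_sub_infDist_sq he h, ← ofReal_norm, ← ENNReal.ofReal_pow (norm_nonneg _)]
  exact ENNReal.ofReal_le_ofReal (sub_le_self _ (sq_nonneg _))

theorem countable_setOf_ne_zero_of_frameEnergy_ne_top [TopologicalSpace.SeparableSpace H]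
    (h : ∀ f, frameEnergy 𝕜 e f ≠ ∞) : {i | e i ≠ 0}.Countable := by
  obtain ⟨S, hS, hdense⟩ := TopologicalSpace.exists_countable_dense H
  refine (hS.biUnion fun f _ => Summable.countable_support_ennreal (h f)).mono fun i hi => ?_
  by_contra hne
  simp only [Set.mem_iUnion, not_exists, Function.mem_support, not_not] at hne
  refine hi (hdense.eq_zero_of_inner_left (𝕜 := 𝕜) fun v hv => ?_)
  simpa using hne v hv

variable [CompleteSpace H] {D : H →ₗᵢ[𝕜] H}

theorem monotone_frameEnergy_iterate (he : ∀ i, e i ∈ K)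
    (h : ∀ f ∈ K, frameEnergy 𝕜 e f = ‖f‖ₑ ^ 2) (hD : ∀ f ∈ K, D f ∈ K) (f : H) :
    Monotone fun j : ℕ => frameEnergy 𝕜 e (D^[j] f) := fun j k hjk => by
  have hanti := antitone_infDist_iterate D.isometry hD ⟨0, zero_mem K⟩ f hjk
  simp only [frameEnergy_eq_sub_infDist_sq he h, ← D.coe_pow, LinearIsometry.norm_map] at hanti ⊢
  gcongr
  exact Metric.infDist_nonneg

theorem tendsto_frameEnergy_iterate (he : ∀ i, e i ∈ K)
    (h : ∀ f ∈ K, frameEnergy 𝕜 e f = ‖f‖ₑ ^ 2) (hD : ∀ f ∈ K, D f ∈ K)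
    (hdense : Dense {f | ∃ j : ℕ, D^[j] f ∈ K}) (f : H) :
    Tendsto (fun j : ℕ => frameEnergy 𝕜 e (D^[j] f)) atTop (𝓝 (‖f‖ₑ ^ 2)) := by
  have hlim := ENNReal.tendsto_ofReal
    (((tendsto_infDist_iterate D.isometry hD hdense f).pow 2).const_sub (‖f‖ ^ 2))
  rw [zero_pow two_ne_zero, sub_zero, ENNReal.ofReal_pow (norm_nonneg _), ofReal_norm] at hlim
  refine hlim.congr fun j => ?_
  rw [frameEnergy_eq_sub_infDist_sq he h, ← D.coe_pow, LinearIsometry.norm_map]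

end Frame

section Measure

variable {α : Type*} [MeasurableSpace α] {μ : Measure α} [SigmaFinite μ]

theorem ae_tendsto_of_monotone_of_tendsto_setLIntegral {F : ℕ → α → ℝ≥0∞} {g : α → ℝ≥0∞}
    (hF : ∀ j, Measurable (F j)) (hg : Measurable g)
    (hmono : ∀ s, MeasurableSet s → Monotone fun j => ∫⁻ x in s, F j x ∂μ)
    (hlim : ∀ s, MeasurableSet s →
      Tendsto (fun j => ∫⁻ x in s, F j x ∂μ) atTop (𝓝 (∫⁻ x in s, g x ∂μ))) :
    ∀ᵐ x ∂μ, Tendsto (fun j => F j x) atTop (𝓝 (g x)) := by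
  have hle : ∀ᵐ x ∂μ, ∀ j, F j x ≤ F (j + 1) x := ae_all_iff.2 fun j =>
    ae_le_of_forall_setLIntegral_le_of_sigmaFinite (hF j) fun s hs _ => hmono s hs j.le_succ
  have hsup : ∀ᵐ x ∂μ, ⨆ j, F j x = g x :=
    ae_eq_of_forall_setLIntegral_eq_of_sigmaFinite (Measurable.iSup hF) hg fun s hs _ => by
      rw [lintegral_iSup_ae hF fun j => ae_restrict_of_ae (hle.mono fun x hx => hx j)]
      exact iSup_eq_of_tendsto (hmono s hs) (hlim s hs)
  filter_upwards [hle, hsup] with x hx hxg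
  exact hxg ▸ tendsto_atTop_iSup (monotone_nat_of_le_succ hx)

end Measure

section Fourier

theorem fourier_comp_div {E : Type*} [NormedAddCommGroup E] [NormedSpace ℂ E] {c : ℝ} (hc : c ≠ 0)
    (f : ℝ → E) (ξ : ℝ) : 𝓕 (fun x => f (x / c)) ξ = |c| • 𝓕 f (c * ξ) := by
  simp only [Real.fourier_real_eq]
  rw [← Measure.integral_comp_div (fun x => Real.fourierChar (-(x * (c * ξ))) • f x) c]
  refine integral_congr_ae (Eventually.of_forall fun x => ?_)
  simp only [← mul_assoc, div_mul_cancel₀ x hc]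

theorem fourier_const_smul {E : Type*} [NormedAddCommGroup E] [NormedSpace ℂ E] (a : ℂ) (f : ℝ → E)
    (ξ : ℝ) : 𝓕 (a • f) ξ = a • 𝓕 f ξ :=
  congrFun (VectorFourier.fourierIntegral_const_smul Real.fourierChar volume (innerₗ ℝ) f a) ξ

theorem fourier_comp_sub_right {E : Type*} [NormedAddCommGroup E] [NormedSpace ℂ E]
    (f : ℝ → E) (a ξ : ℝ) :
    𝓕 (fun x => f (x - a)) ξ = Real.fourierChar (-(a * ξ)) • 𝓕 f ξ := by
  have := congrFun (VectorFourier.fourierIntegral_comp_add_right Real.fourierChar volume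
    (innerₗ ℝ) f (-a)) ξ
  rwa [innerₗ_apply_apply, real_inner_comm, inner_neg_right] at this

theorem fourier_map_eq_of_schwartz {A B : L2R → L2R} (hA : Continuous A) (hB : Continuous B)
    (h : ∀ f : 𝓢(ℝ, ℂ), (𝓕 (A (f.toLp 2)) : L2R) = B ((𝓕 f).toLp 2)) (f : L2R) :
    (𝓕 (A f) : L2R) = B (𝓕 f : L2R) := by
  have hcont : Continuous fun f : L2R => (𝓕 f : L2R) := (Lp.fourierTransformₗᵢ ℝ ℂ).continuous
  have hdense : DenseRange fun f : 𝓢(ℝ, ℂ) => (f.toLp 2 : L2R) :=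
    SchwartzMap.denseRange_toLpCLM ENNReal.ofNat_ne_top
  refine congrFun (hdense.equalizer (hcont.comp hA) (hB.comp hcont) (funext fun f => ?_)) f
  simp only [Function.comp_apply, h, SchwartzMap.toLp_fourier_eq]

theorem dilIsometry_toLp_eq {c : ℝ} (hc : 0 < c) {f g : 𝓢(ℝ, ℂ)}
    (h : ∀ x, g x = ((√c)⁻¹ : ℂ) * f (x / c)) : dilIsometry hc (f.toLp 2) = g.toLp 2 := by
  apply Lp.ext
  filter_upwards [dilIsometry_coe hc (f.toLp 2), g.coeFn_toLp 2 volume,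
    (quasiMP_div hc).ae_eq_comp (f.coeFn_toLp 2 volume)] with x hdil hg hf
  rw [hdil, hg, h]
  exact congrArg _ hf

theorem fourier_dilIsometry {c : ℝ} (hc : 0 < c) (f : L2R) :
    (𝓕 (dilIsometry hc f) : L2R) = dilIsometry (inv_pos.2 hc) (𝓕 f : L2R) := by
  refine fourier_map_eq_of_schwartz (dilIsometry hc).continuous
    (dilIsometry (inv_pos.2 hc)).continuous (fun f => ?_) f
  let g : 𝓢(ℝ, ℂ) := ((√c)⁻¹ : ℂ) • SchwartzMap.compCLMOfContinuousLinearEquiv ℂ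
    (ContinuousLinearEquiv.unitsEquivAut ℝ (Units.mk0 c⁻¹ (inv_ne_zero hc.ne'))) f
  have hg : (g : ℝ → ℂ) = ((√c)⁻¹ : ℂ) • fun x => f (x / c) := by
    ext x
    simp [g, div_eq_mul_inv]
  have hsqrt : ((√c)⁻¹ : ℂ) * c = √c := by
    norm_cast
    rw [inv_mul_eq_div, Real.div_sqrt]
  rw [dilIsometry_toLp_eq hc (congrFun hg), SchwartzMap.toLp_fourier_eq]
  refine (dilIsometry_toLp_eq (inv_pos.2 hc) fun ξ => ?_).symm
  rw [SchwartzMap.fourier_coe, SchwartzMap.fourier_coe, hg, fourier_const_smul,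
    fourier_comp_div hc.ne', abs_of_pos hc, Real.sqrt_inv, div_inv_eq_mul, mul_comm c ξ,
    Complex.real_smul, smul_eq_mul, ← mul_assoc, hsqrt, Complex.ofReal_inv, inv_inv]

theorem T₀_toLp_eq {f g : 𝓢(ℝ, ℂ)} (h : ∀ x, g x = f (x - 1)) : T₀ (f.toLp 2) = g.toLp 2 := by
  apply Lp.ext
  filter_upwards [T₀_coe (f.toLp 2), g.coeFn_toLp 2 volume,
    (measurePreserving_sub_right volume (1 : ℝ)).quasiMeasurePreserving.ae_eq_comp
      (f.coeFn_toLp 2 volume)] with x hT₀ hg hf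
  rw [hT₀, hg, h]
  exact hf

theorem memLp_top_fourierChar_neg :
    MemLp (fun ξ : ℝ => (Real.fourierChar (-ξ) : ℂ)) ∞ (volume : Measure ℝ) :=
  memLp_top_of_bound (Continuous.aestronglyMeasurable (by fun_prop)) 1
    (Eventually.of_forall fun _ => (Circle.norm_coe _).le)

/-- Multiplication by `ξ ↦ e^{-2πiξ}` on `L²(ℝ)`, the Fourier side of the translation `T₀`. -/
def modulation : L2R →L[ℂ] L2R :=
  (ContinuousLinearMap.mul ℂ ℂ).holderL volume ∞ 2 2 (memLp_top_fourierChar_neg.toLp _)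

theorem modulation_coe (f : L2R) :
    modulation f =ᵐ[volume] fun ξ : ℝ => (Real.fourierChar (-ξ) : ℂ) * f ξ := by
  filter_upwards [(ContinuousLinearMap.mul ℂ ℂ).coeFn_holder (r := 2)
    (memLp_top_fourierChar_neg.toLp _) f, memLp_top_fourierChar_neg.coeFn_toLp] with ξ hmul hchar
  rw [modulation, ContinuousLinearMap.holderL_apply_apply, hmul, hchar]
  rfl

theorem fourier_T₀ (f : L2R) : (𝓕 (T₀ f) : L2R) = modulation (𝓕 f) := by
  refine fourier_map_eq_of_schwartz T₀.continuous modulation.continuous (fun f => ?_) f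
  rw [T₀_toLp_eq (g := f.compSubConstCLM ℂ 1) fun _ => rfl, SchwartzMap.toLp_fourier_eq]
  apply Lp.ext
  filter_upwards [modulation_coe ((𝓕 f).toLp 2), (𝓕 f).coeFn_toLp 2 volume,
    (𝓕 (f.compSubConstCLM ℂ 1)).coeFn_toLp 2 volume] with ξ hmod hf hshift
  rw [hmod, hf, hshift, SchwartzMap.fourier_coe, SchwartzMap.fourier_coe]
  have := fourier_comp_sub_right f 1 ξ
  rwa [one_mul] at this

theorem fourier_T_zpow {n : ℕ} (z : Fin n → Circle) (k : ℤ) (f : L2Rn n) (i : Fin n) :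
    (𝓕 ((T z ^ k) f i) : L2R) =ᵐ[volume]
      fun ξ => (((z i * Real.fourierChar (-ξ)) ^ k : Circle) : ℂ) * (𝓕 (f i) : L2R) ξ := by
  have hstep (k : ℤ) : (𝓕 ((T z ^ (k + 1)) f i) : L2R) =ᵐ[volume] fun ξ =>
      ((z i * Real.fourierChar (-ξ) : Circle) : ℂ) * (𝓕 ((T z ^ k) f i) : L2R) ξ := by
    have hT : (𝓕 ((T z ^ (k + 1)) f i) : L2R) = (z i : ℂ) • modulation (𝓕 ((T z ^ k) f i)) := by
      rw [add_comm, zpow_add, zpow_one, LinearIsometryEquiv.coe_mul, Function.comp_apply,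
        T_apply, FourierTransform.fourier_smul, fourier_T₀]
    rw [hT]
    filter_upwards [Lp.coeFn_smul (z i : ℂ) (modulation (𝓕 ((T z ^ k) f i))),
      modulation_coe (𝓕 ((T z ^ k) f i))] with ξ hsmul hmod
    rw [hsmul, Pi.smul_apply, hmod, smul_eq_mul, Circle.coe_mul, mul_assoc]
  induction k using Int.induction_on with
  | zero => simp
  | succ k ih =>
    filter_upwards [hstep k, ih] with ξ hξ hk
    rw [hξ, hk, ← mul_assoc, ← Circle.coe_mul, ← zpow_one_add, add_comm]
  | pred k ih =>
    have hprev := hstep (-k - 1)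
    rw [sub_add_cancel] at hprev
    filter_upwards [hprev, ih] with ξ hξ hk
    refine mul_left_cancel₀ (z i * Real.fourierChar (-ξ)).coe_ne_zero ?_
    rw [← hξ, hk, ← mul_assoc, ← Circle.coe_mul, ← zpow_one_add, add_sub_cancel]

end Fourier

section Parseval

theorem tsum_enorm_integral_fourierChar_sq {a : ℝ} {h : ℝ → ℂ} (hh : MemLp h 2 volume)
    (hsupp : ∀ᵐ ξ, ξ ∉ Set.Ioc a (a + 1) → h ξ = 0) :
    ∑' k : ℤ, ‖∫ ξ, (Real.fourierChar (-(k * ξ)) : ℂ) * h ξ‖ₑ ^ 2 = ∫⁻ ξ, ‖h ξ‖ₑ ^ 2 := by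
  have hab : a < a + 1 := lt_add_one a
  have hlength : a + 1 - a = 1 := add_sub_cancel_left a 1
  have hint {E : Type} [NormedAddCommGroup E] [NormedSpace ℝ E] {g : ℝ → E}
      (hg : ∀ ξ, h ξ = 0 → g ξ = 0) : ∫ ξ in a..a + 1, g ξ = ∫ ξ, g ξ := by
    rw [intervalIntegral.integral_of_le hab.le]
    exact setIntegral_eq_integral_of_ae_compl_eq_zero
      (hsupp.mono fun ξ hsupp hξ => hg ξ (hsupp hξ))
  have hcoeff (k : ℤ) : fourierCoeffOn hab h k =
      ∫ ξ, (Real.fourierChar (-(k * ξ)) : ℂ) * h ξ := by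
    rw [fourierCoeffOn_eq_integral, hint fun ξ hξ => by rw [hξ, smul_zero], hlength, div_one,
      one_smul]
    refine integral_congr_ae (Eventually.of_forall fun ξ => ?_)
    simp only [fourier_coe_apply, Real.fourierChar_apply, smul_eq_mul]
    congr 2
    push_cast
    ring
  have hsum := hasSum_sq_fourierCoeffOn hab (hh.restrict (Set.Ioc a (a + 1)))
  rw [hint fun ξ hξ => by simp [hξ], hlength, inv_one, one_smul] at hsum
  simp only [hcoeff] at hsum
  have htsum := ENNReal.ofReal_tsum_of_nonneg
    (fun k : ℤ => sq_nonneg ‖∫ ξ, (Real.fourierChar (-(k * ξ)) : ℂ) * h ξ‖) hsum.summable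
  rw [hsum.tsum_eq, ofReal_integral_eq_lintegral_ofReal (hh.integrable_norm_pow two_ne_zero)
    (Eventually.of_forall fun ξ => sq_nonneg _)] at htsum
  simpa only [ENNReal.ofReal_pow (norm_nonneg _), ofReal_norm] using htsum.symm

end Parseval

section LocalTrace

variable {n : ℕ} {z : Fin n → Circle} {Φ : Set (L2Rn n)}

/-- The sum `∑_{φ ∈ Φ} |𝓕 φᵢ (ξ)|²` for Mathlib's normalization of the Fourier transform: the
`i`-th diagonal entry of the local trace function of the shift invariant space generated by `Φ`. -/
def localTrace (Φ : Set (L2Rn n)) (i : Fin n) (ξ : ℝ) : ℝ≥0∞ :=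
  ∑' φ : Φ, ‖(𝓕 ((φ : L2Rn n) i) : L2R) ξ‖ₑ ^ 2

theorem measurable_enorm_sq (f : L2R) : Measurable fun ξ => ‖f ξ‖ₑ ^ 2 :=
  (Lp.stronglyMeasurable f).measurable.enorm.pow_const 2

theorem measurable_localTrace (hΦ : Φ.Countable) (i : Fin n) : Measurable (localTrace Φ i) :=
  have := hΦ.to_subtype
  Measurable.tsum fun _ => measurable_enorm_sq _

/-- The family `T^k φ` of all shifts of members of `Φ`, indexed as in `IsNTFGenerator`. -/
def shifts (z : Fin n → Circle) (Φ : Set (L2Rn n)) : ℤ × Φ → L2Rn n :=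
  fun p => (T z ^ p.1) (p.2 : L2Rn n)

theorem enorm_inner_T_zpow_single (z : Fin n → Circle) (k : ℤ) (f : L2Rn n) (i : Fin n) (g : L2R) :
    ‖inner ℂ ((T z ^ k) f) (PiLp.single 2 i g)‖ₑ =
      ‖∫ ξ, (Real.fourierChar (-(k * ξ)) : ℂ) *
        ((𝓕 (f i) : L2R) ξ * star ((𝓕 g : L2R) ξ))‖ₑ := by
  have hinner : inner ℂ (PiLp.single 2 i g : L2Rn n) ((T z ^ k) f) = ((z i ^ k : Circle) : ℂ) *
      ∫ ξ, (Real.fourierChar (-(k * ξ)) : ℂ) * ((𝓕 (f i) : L2R) ξ * star ((𝓕 g : L2R) ξ)) := by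
    rw [PiLp.inner_apply, Finset.sum_eq_single i
      (fun l _ hl => by rw [PiLp.single_eq_of_ne 2 hl, inner_zero_left]) (by simp),
      PiLp.single_eq_same, ← Lp.inner_fourier_eq, L2.inner_def, ← integral_const_mul]
    refine integral_congr_ae ?_
    filter_upwards [fourier_T_zpow z k f i] with ξ hξ
    have hchar : Real.fourierChar (-ξ) ^ k = Real.fourierChar (-(k * ξ)) := by
      rw [← AddChar.map_zsmul_eq_zpow, zsmul_eq_mul, mul_neg]
    rw [hξ, RCLike.inner_apply, mul_zpow, hchar, Circle.coe_mul, ← starRingEnd_apply]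
    ring
  rw [← ofReal_norm, norm_inner_symm, hinner, norm_mul, Circle.norm_coe, one_mul, ofReal_norm]

theorem frameEnergy_shifts_single (hΦ : Φ.Countable) (i : Fin n) {a C : ℝ} {g : L2R}
    (hbdd : ∀ᵐ ξ, ‖(𝓕 g : L2R) ξ‖ ≤ C)
    (hsupp : ∀ᵐ ξ, ξ ∉ Set.Ioc a (a + 1) → (𝓕 g : L2R) ξ = 0) :
    frameEnergy ℂ (shifts z Φ) (PiLp.single 2 i g) =
      ∫⁻ ξ, localTrace Φ i ξ * ‖(𝓕 g : L2R) ξ‖ₑ ^ 2 := by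
  have := hΦ.to_subtype
  have hmem (f : L2R) : MemLp (fun ξ => f ξ * star ((𝓕 g : L2R) ξ)) 2 volume :=
    (memLp_top_of_bound (Lp.aestronglyMeasurable _) C hbdd).star.mul (Lp.memLp f)
  have hcoeff (φ : L2Rn n) : ∑' k : ℤ, ‖inner ℂ ((T z ^ k) φ) (PiLp.single 2 i g)‖ₑ ^ 2 =
      ∫⁻ ξ, ‖(𝓕 (φ i) : L2R) ξ‖ₑ ^ 2 * ‖(𝓕 g : L2R) ξ‖ₑ ^ 2 := by
    simp only [enorm_inner_T_zpow_single]
    rw [tsum_enorm_integral_fourierChar_sq (hmem _)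
      (hsupp.mono fun ξ hsupp hξ => by rw [hsupp hξ, star_zero, mul_zero])]
    simp only [enorm_mul, ← starRingEnd_apply, RCLike.enorm_conj, mul_pow]
  calc frameEnergy ℂ (shifts z Φ) (PiLp.single 2 i g)
      = ∑' (φ : Φ) (k : ℤ), ‖inner ℂ ((T z ^ k) (φ : L2Rn n)) (PiLp.single 2 i g)‖ₑ ^ 2 := by
        rw [ENNReal.tsum_comm, ← ENNReal.tsum_prod]
        rfl
    _ = ∫⁻ ξ, ∑' φ : Φ, ‖(𝓕 ((φ : L2Rn n) i) : L2R) ξ‖ₑ ^ 2 * ‖(𝓕 g : L2R) ξ‖ₑ ^ 2 := by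
        rw [lintegral_tsum fun φ =>
          ((measurable_enorm_sq _).fun_mul (measurable_enorm_sq _)).aemeasurable]
        exact tsum_congr fun φ => hcoeff φ
    _ = ∫⁻ ξ, localTrace Φ i ξ * ‖(𝓕 g : L2R) ξ‖ₑ ^ 2 := by
        simp only [ENNReal.tsum_mul_right, localTrace]

/-- The vector of `L²(ℝ)ⁿ` whose `i`-th component has Fourier transform `1_A` and whose other
components vanish. -/
def indicatorVec (i : Fin n) {A : Set ℝ} (hA : MeasurableSet A) (hA' : volume A ≠ ∞) : L2Rn n :=
  PiLp.single 2 i (𝓕⁻ (indicatorConstLp 2 hA hA' (1 : ℂ)) : L2R)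

variable {A : Set ℝ} (hA : MeasurableSet A) (hA' : volume A ≠ ∞)

theorem fourier_fourierInv_indicatorConstLp :
    (𝓕 (𝓕⁻ (indicatorConstLp 2 hA hA' (1 : ℂ)) : L2R) : L2R) =ᵐ[volume] A.indicator 1 := by
  rw [FourierTransform.fourier_fourierInv_eq]
  exact indicatorConstLp_coeFn

theorem norm_fourier_fourierInv_indicatorConstLp_le_one :
    ∀ᵐ ξ, ‖(𝓕 (𝓕⁻ (indicatorConstLp 2 hA hA' (1 : ℂ)) : L2R) : L2R) ξ‖ ≤ 1 := by
  filter_upwards [fourier_fourierInv_indicatorConstLp hA hA'] with ξ hξ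
  rw [hξ]
  exact (norm_indicator_le_norm_self 1 ξ).trans norm_one.le

theorem lintegral_mul_enorm_fourier_indicator_sq (F : ℝ → ℝ≥0∞) :
    ∫⁻ ξ, F ξ * ‖(𝓕 (𝓕⁻ (indicatorConstLp 2 hA hA' (1 : ℂ)) : L2R) : L2R) ξ‖ₑ ^ 2 =
      ∫⁻ ξ in A, F ξ := by
  rw [← lintegral_indicator hA]
  refine lintegral_congr_ae ?_
  filter_upwards [fourier_fourierInv_indicatorConstLp hA hA'] with ξ hξ
  rw [hξ]
  by_cases hmem : ξ ∈ A <;> simp [hmem]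

theorem enorm_indicatorVec_sq (i : Fin n) : ‖indicatorVec i hA hA'‖ₑ ^ 2 = volume A := by
  have hnorm : ‖indicatorVec i hA hA'‖ = ‖(indicatorConstLp 2 hA hA' (1 : ℂ) : L2R)‖ := by
    rw [indicatorVec, PiLp.norm_single]
    exact (Lp.fourierTransformₗᵢ ℝ ℂ).symm.norm_map _
  rw [← ofReal_norm, hnorm, ofReal_norm, Lp.enorm_def, eLpNorm_congr_ae indicatorConstLp_coeFn,
    eLpNorm_indicator_const hA two_ne_zero ENNReal.ofNat_ne_top, enorm_one, one_mul,
    ← ENNReal.rpow_natCast, ← ENNReal.rpow_mul]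
  simp

theorem frameEnergy_shifts_indicatorVec (hΦ : Φ.Countable) (i : Fin n) {a : ℝ}
    (hAa : A ⊆ Set.Ioc a (a + 1)) :
    frameEnergy ℂ (shifts z Φ) (indicatorVec i hA hA') = ∫⁻ ξ in A, localTrace Φ i ξ := by
  have hfourier := fourier_fourierInv_indicatorConstLp hA hA'
  rw [indicatorVec, frameEnergy_shifts_single hΦ i
    (norm_fourier_fourierInv_indicatorConstLp_le_one hA hA')
    (hfourier.mono fun ξ hξ hIoc => by rw [hξ, Set.indicator_of_notMem fun h => hIoc (hAa h)]),
    lintegral_mul_enorm_fourier_indicator_sq]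

end LocalTrace

section Dilation

variable {n : ℕ} {z : Fin n → Circle} {Φ : Set (L2Rn n)} {c : ℝ}

theorem dilIsometry_dilIsometry {d : ℝ} (hc : 0 < c) (hd : 0 < d) (f : L2R) :
    dilIsometry hc (dilIsometry hd f) = dilIsometry (mul_pos hc hd) f := by
  apply Lp.ext
  filter_upwards [dilIsometry_coe hc (dilIsometry hd f), dilIsometry_coe (mul_pos hc hd) f,
    (quasiMP_div hc).ae_eq_comp (dilIsometry_coe hd f)] with x hout hprod hin
  simp only [Function.comp_apply] at hin
  rw [hout, hprod, hin, Real.sqrt_mul hc.le, div_div, Complex.ofReal_mul, mul_inv, mul_assoc]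

theorem dilIsometry_one (f : L2R) : dilIsometry one_pos f = f := by
  apply Lp.ext
  filter_upwards [dilIsometry_coe one_pos f] with x hx
  simp [hx]

/-- The permuted dilation `(f₁, ..., fₙ) ↦ (D f_{σ(1)}, ..., D f_{σ(n)})` of `L²(ℝ)ⁿ`, where
`D f (x) = c^{-1/2} f (x / c)`; for `c = N` it is `U`. -/
def permDilation (hc : 0 < c) (σ : Equiv.Perm (Fin n)) : L2Rn n →ₗᵢ[ℂ] L2Rn n where
  toFun f := WithLp.toLp 2 fun i => dilIsometry hc (f (σ i))
  map_add' f g := by ext1 i; exact map_add (dilIsometry hc) _ _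
  map_smul' a f := by ext1 i; exact map_smul (dilIsometry hc) _ _
  norm_map' f := by
    change ‖WithLp.toLp 2 fun i => dilIsometry hc (f (σ i))‖ = ‖f‖
    simp only [PiLp.norm_eq_of_L2, LinearIsometry.norm_map]
    rw [Equiv.sum_comp σ fun i => ‖f i‖ ^ 2]

theorem permDilation_apply (hc : 0 < c) (σ : Equiv.Perm (Fin n)) (f : L2Rn n) (i : Fin n) :
    permDilation hc σ f i = dilIsometry hc (f (σ i)) := rfl

theorem permDilation_iterate (hc : 0 < c) (σ : Equiv.Perm (Fin n)) (j : ℕ) (f : L2Rn n) :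
    (permDilation hc σ)^[j] f = permDilation (pow_pos hc j) (σ ^ j) f := by
  induction j with
  | zero =>
    ext1 i
    simp only [Function.iterate_zero, id, permDilation_apply, pow_zero, dilIsometry_one,
      Equiv.Perm.one_apply]
  | succ j ih =>
    rw [Function.iterate_succ_apply', ih]
    ext1 i
    simp only [permDilation_apply, dilIsometry_dilIsometry, pow_succ' c, pow_succ σ,
      Equiv.Perm.mul_apply]

theorem permDilation_single (hc : 0 < c) (σ : Equiv.Perm (Fin n)) (i : Fin n) (g : L2R) :
    permDilation hc σ (PiLp.single 2 i g) = PiLp.single 2 (σ.symm i) (dilIsometry hc g) := by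
  ext1 k
  obtain rfl | hk := eq_or_ne k (σ.symm i)
  · simp [permDilation_apply]
  · rw [permDilation_apply, PiLp.single_eq_of_ne 2 hk, PiLp.single_eq_of_ne 2, map_zero]
    rwa [Ne, ← Equiv.eq_symm_apply]

theorem lintegral_comp_div (hc : 0 < c) (F : ℝ → ℝ≥0∞) :
    ∫⁻ x, F (x / c) = ENNReal.ofReal c * ∫⁻ x, F x := by
  have hmap := (Homeomorph.mulRight₀ c⁻¹ (inv_ne_zero hc.ne')).measurableEmbedding.lintegral_map
    (μ := volume) F
  rw [Homeomorph.coe_mulRight₀, Real.map_volume_mul_right (inv_ne_zero hc.ne'), inv_inv,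
    abs_of_pos hc, lintegral_smul_measure, smul_eq_mul] at hmap
  exact hmap.symm

theorem fourier_dilIsometry_coe (hc : 0 < c) (g : L2R) :
    (𝓕 (dilIsometry hc g) : L2R) =ᵐ[volume] fun ξ => (√c : ℂ) * (𝓕 g : L2R) (c * ξ) := by
  rw [fourier_dilIsometry]
  filter_upwards [dilIsometry_coe (inv_pos.2 hc) (𝓕 g)] with ξ hξ
  rw [hξ, Real.sqrt_inv, Complex.ofReal_inv, inv_inv, div_inv_eq_mul, mul_comm ξ]

theorem ae_comp_mul_left {p : ℝ → Prop} (hc : 0 < c) (hp : ∀ᵐ ξ, p ξ) : ∀ᵐ ξ, p (c * ξ) := by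
  simpa only [div_inv_eq_mul, mul_comm] using (quasiMP_div (inv_pos.2 hc)).ae hp

theorem frameEnergy_shifts_permDilation_single (hΦ : Φ.Countable) (hc : 0 < c)
    (σ : Equiv.Perm (Fin n)) (i : Fin n) {a C : ℝ} {g : L2R}
    (hbdd : ∀ᵐ ξ, ‖(𝓕 g : L2R) ξ‖ ≤ C)
    (hsupp : ∀ᵐ ξ, ξ / c ∉ Set.Ioc a (a + 1) → (𝓕 g : L2R) ξ = 0) :
    frameEnergy ℂ (shifts z Φ) (permDilation hc σ (PiLp.single 2 i g)) =
      ∫⁻ ξ, localTrace Φ (σ.symm i) (ξ / c) * ‖(𝓕 g : L2R) ξ‖ₑ ^ 2 := by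
  have hbdd' : ∀ᵐ ξ, ‖(𝓕 (dilIsometry hc g) : L2R) ξ‖ ≤ √c * C := by
    filter_upwards [fourier_dilIsometry_coe hc g, ae_comp_mul_left hc hbdd] with ξ hξ hC
    rw [hξ, norm_mul, Complex.norm_real, Real.norm_of_nonneg (Real.sqrt_nonneg c)]
    gcongr
  have hsupp' : ∀ᵐ ξ, ξ ∉ Set.Ioc a (a + 1) → (𝓕 (dilIsometry hc g) : L2R) ξ = 0 := by
    filter_upwards [fourier_dilIsometry_coe hc g, ae_comp_mul_left hc hsupp] with ξ hξ hzero hIoc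
    rw [hξ, hzero (by rwa [mul_div_cancel_left₀ ξ hc.ne']), mul_zero]
  have hsq : ∀ᵐ ξ, ‖(𝓕 (dilIsometry hc g) : L2R) ξ‖ₑ ^ 2 =
      ENNReal.ofReal c * ‖(𝓕 g : L2R) (c * ξ)‖ₑ ^ 2 := by
    filter_upwards [fourier_dilIsometry_coe hc g] with ξ hξ
    rw [hξ, enorm_mul, mul_pow, ← ofReal_norm, Complex.norm_real,
      Real.norm_of_nonneg (Real.sqrt_nonneg c), ← ENNReal.ofReal_pow (Real.sqrt_nonneg c),
      Real.sq_sqrt hc.le]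
  calc frameEnergy ℂ (shifts z Φ) (permDilation hc σ (PiLp.single 2 i g))
      = ∫⁻ ξ, localTrace Φ (σ.symm i) ξ * ‖(𝓕 (dilIsometry hc g) : L2R) ξ‖ₑ ^ 2 := by
        rw [permDilation_single, frameEnergy_shifts_single hΦ _ hbdd' hsupp']
    _ = ENNReal.ofReal c * ∫⁻ ξ, localTrace Φ (σ.symm i) ξ * ‖(𝓕 g : L2R) (c * ξ)‖ₑ ^ 2 := by
        rw [← lintegral_const_mul' _ _ ENNReal.ofReal_ne_top]
        refine lintegral_congr_ae (hsq.mono fun ξ hξ => ?_)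
        simp only [hξ, mul_left_comm]
    _ = ∫⁻ ξ, localTrace Φ (σ.symm i) (ξ / c) * ‖(𝓕 g : L2R) ξ‖ₑ ^ 2 := by
        rw [← lintegral_comp_div hc]
        simp only [mul_div_cancel₀ _ hc.ne']

theorem frameEnergy_shifts_permDilation_indicatorVec (hΦ : Φ.Countable) (hc : 0 < c)
    (σ : Equiv.Perm (Fin n)) (i : Fin n) {a : ℝ} {A : Set ℝ} (hA : MeasurableSet A)
    (hA' : volume A ≠ ∞) (hAa : ∀ ξ ∈ A, ξ / c ∈ Set.Ioc a (a + 1)) :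
    frameEnergy ℂ (shifts z Φ) (permDilation hc σ (indicatorVec i hA hA')) =
      ∫⁻ ξ in A, localTrace Φ (σ.symm i) (ξ / c) := by
  have hfourier := fourier_fourierInv_indicatorConstLp hA hA'
  rw [indicatorVec, frameEnergy_shifts_permDilation_single hΦ hc σ i
    (norm_fourier_fourierInv_indicatorConstLp_le_one hA hA')
    (hfourier.mono fun ξ hξ hIoc => by
      rw [hξ, Set.indicator_of_notMem fun h => hIoc (hAa ξ h)]),
    lintegral_mul_enorm_fourier_indicator_sq _ _ fun ξ => localTrace Φ (σ.symm i) (ξ / c)]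

end Dilation

section Generator

variable {n : ℕ} {z : Fin n → Circle} {Φ : Set (L2Rn n)} {W : Submodule ℂ (L2Rn n)}

theorem IsNTFGenerator.frameEnergy_shifts (hΦ : IsNTFGenerator z Φ W) :
    ∀ f ∈ W, frameEnergy ℂ (shifts z Φ) f = ‖f‖ₑ ^ 2 :=
  fun f hf => frameEnergy_eq_of_hasSum (hΦ.2.2 f hf)

theorem IsNTFGenerator.countable (hΦ : IsNTFGenerator z Φ W) : Φ.Countable := by
  have : Fact ((2 : ℝ≥0∞) ≠ ∞) := ⟨ENNReal.ofNat_ne_top⟩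
  have hcount := countable_setOf_ne_zero_of_frameEnergy_ne_top fun f =>
    ne_top_of_le_ne_top (by finiteness) (frameEnergy_le_enorm_sq hΦ.2.1 hΦ.frameEnergy_shifts f)
  refine ((hcount.image fun p => (p.2 : L2Rn n)).insert 0).mono fun φ hφ => ?_
  obtain rfl | hne := eq_or_ne φ 0
  · exact Or.inl rfl
  · exact Or.inr ⟨(0, ⟨φ, hφ⟩), by simpa [shifts] using hne, rfl⟩

theorem ae_localTrace_le_one (hΦ : IsNTFGenerator z Φ W) (i : Fin n) :
    ∀ᵐ ξ, localTrace Φ i ξ ≤ 1 := by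
  have hunit (k : ℤ) :
      ∀ᵐ ξ ∂volume.restrict (Set.Ioc (k : ℝ) (k + 1)), localTrace Φ i ξ ≤ 1 := by
    refine ae_le_of_forall_setLIntegral_le_of_sigmaFinite (g := fun _ => 1)
      (measurable_localTrace hΦ.countable i) fun s hs _ => ?_
    have hsm := hs.inter (measurableSet_Ioc (a := (k : ℝ)) (b := k + 1))
    have hfin : volume (s ∩ Set.Ioc (k : ℝ) (k + 1)) ≠ ∞ :=
      measure_ne_top_of_subset Set.inter_subset_right measure_Ioc_lt_top.ne
    rw [Measure.restrict_restrict hs, setLIntegral_one, ← enorm_indicatorVec_sq hsm hfin i,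
      ← frameEnergy_shifts_indicatorVec (z := z) hsm hfin hΦ.countable i Set.inter_subset_right]
    exact frameEnergy_le_enorm_sq hΦ.2.1 hΦ.frameEnergy_shifts _
  have hall := (ae_restrict_iUnion_iff _ _).2 hunit
  rwa [iUnion_Ioc_intCast, Measure.restrict_univ] at hall

variable {c : ℝ} (hc : 1 < c) {σ : Equiv.Perm (Fin n)}

theorem frameEnergy_shifts_permDilation_iterate_indicatorVec (hΦ : Φ.Countable) (i : Fin n)
    {A : Set ℝ} (hA : MeasurableSet A) (hA' : volume A ≠ ∞) {J : ℕ}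
    (hAJ : A ⊆ Set.Ioc (-c ^ J / 2) (c ^ J / 2)) (j : ℕ) :
    frameEnergy ℂ (shifts z Φ) ((permDilation (one_pos.trans hc) σ)^[j + J]
      (indicatorVec i hA hA')) =
        ∫⁻ ξ in A, localTrace Φ ((σ ^ (j + J)).symm i) (ξ / c ^ (j + J)) := by
  have hunit : ∀ ξ ∈ A, ξ / c ^ (j + J) ∈ Set.Ioc (-(1 / 2) : ℝ) (-(1 / 2) + 1) := by
    intro ξ hξ
    obtain ⟨hleft, hright⟩ := hAJ hξ
    have hpow : c ^ J ≤ c ^ (j + J) := pow_le_pow_right₀ hc.le (Nat.le_add_left J j)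
    rw [Set.mem_Ioc, lt_div_iff₀ (by positivity), div_le_iff₀ (by positivity)]
    constructor <;> linarith
  rw [permDilation_iterate, frameEnergy_shifts_permDilation_indicatorVec hΦ _ _ i _ _ hunit]

theorem ae_restrict_tendsto_localTrace_perm (hΦ : IsNTFGenerator z Φ W)
    (hW : ∀ f ∈ W, permDilation (one_pos.trans hc) σ f ∈ W)
    (hdense : Dense {f | ∃ j : ℕ, (permDilation (one_pos.trans hc) σ)^[j] f ∈ W})
    (i : Fin n) (J : ℕ) :
    ∀ᵐ ξ ∂volume.restrict (Set.Ioc (-c ^ J / 2) (c ^ J / 2)),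
      Tendsto (fun j : ℕ => localTrace Φ ((σ ^ j).symm i) (ξ / c ^ j)) atTop (𝓝 1) := by
  set B := Set.Ioc (-c ^ J / 2) (c ^ J / 2)
  have hBm : MeasurableSet B := measurableSet_Ioc
  have hfin (s : Set ℝ) : volume (s ∩ B) ≠ ∞ :=
    measure_ne_top_of_subset Set.inter_subset_right measure_Ioc_lt_top.ne
  have henergy (s : Set ℝ) (hs : MeasurableSet s) (j : ℕ) :
      ∫⁻ ξ in s, localTrace Φ ((σ ^ (j + J)).symm i) (ξ / c ^ (j + J)) ∂volume.restrict B =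
        frameEnergy ℂ (shifts z Φ) ((permDilation (one_pos.trans hc) σ)^[j + J]
          (indicatorVec i (hs.inter hBm) (hfin s))) := by
    rw [Measure.restrict_restrict hs, frameEnergy_shifts_permDilation_iterate_indicatorVec hc
      hΦ.countable i _ _ Set.inter_subset_right]
  suffices ∀ᵐ ξ ∂volume.restrict B, Tendsto
      (fun j : ℕ => localTrace Φ ((σ ^ (j + J)).symm i) (ξ / c ^ (j + J))) atTop (𝓝 1) from
    this.mono fun ξ hξ => (tendsto_add_atTop_iff_nat J).1 hξ
  refine ae_tendsto_of_monotone_of_tendsto_setLIntegral (g := fun _ => 1)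
    (fun j => (measurable_localTrace hΦ.countable _).comp (measurable_id.div_const _))
    measurable_const (fun s hs => ?_) fun s hs => ?_
  · simp only [henergy s hs]
    exact (monotone_frameEnergy_iterate hΦ.2.1 hΦ.frameEnergy_shifts hW _).comp
      (add_left_mono (a := J))
  · simp only [henergy s hs]
    rw [setLIntegral_one, Measure.restrict_apply hs,
      ← enorm_indicatorVec_sq (hs.inter hBm) (hfin s) i]
    exact (tendsto_add_atTop_iff_nat J).2
      (tendsto_frameEnergy_iterate hΦ.2.1 hΦ.frameEnergy_shifts hW hdense _)

theorem ae_tendsto_localTrace (hΦ : IsNTFGenerator z Φ W)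
    (hW : ∀ f ∈ W, permDilation (one_pos.trans hc) σ f ∈ W)
    (hdense : Dense {f | ∃ j : ℕ, (permDilation (one_pos.trans hc) σ)^[j] f ∈ W}) :
    ∀ᵐ ξ, ∀ i, Tendsto (fun j : ℕ => localTrace Φ i (ξ / c ^ j)) atTop (𝓝 1) := by
  have hperm : ∀ᵐ ξ, ∀ i (J : ℕ), ξ ∈ Set.Ioc (-c ^ J / 2) (c ^ J / 2) →
      Tendsto (fun j : ℕ => localTrace Φ ((σ ^ j).symm i) (ξ / c ^ j)) atTop (𝓝 1) :=
    ae_all_iff.2 fun i => ae_all_iff.2 fun J => (ae_restrict_iff' measurableSet_Ioc).1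
      (ae_restrict_tendsto_localTrace_perm hc hΦ hW hdense i J)
  filter_upwards [hperm] with ξ hξ i
  obtain ⟨J, hJ⟩ := ((tendsto_pow_atTop_atTop_of_one_lt hc).eventually_gt_atTop (2 * |ξ|)).exists
  have hlim (k : Fin n) := hξ k J
    ⟨by linarith [neg_abs_le ξ], by linarith [le_abs_self ξ]⟩
  refine tendsto_def.2 fun s hs => ?_
  filter_upwards [eventually_all.2 fun k => (hlim k).eventually hs] with j hj
  exact Equiv.symm_apply_apply (σ ^ j) i ▸ hj ((σ ^ j) i)

theorem toReal_localTrace_div_two_pi (Φ : Set (L2Rn n)) (i : Fin n) (ξ : ℝ) :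
    (localTrace Φ i (ξ / (2 * Real.pi))).toReal = ∑' φ : Φ, ‖hat ((φ : L2Rn n) i) ξ‖ ^ 2 := by
  rw [localTrace, ENNReal.tsum_toReal_eq fun _ => by finiteness]
  simp only [ENNReal.toReal_pow, toReal_enorm, hat]

theorem summable_norm_hat_sq {i : Fin n} {ξ : ℝ}
    (h : localTrace Φ i (ξ / (2 * Real.pi)) ≠ ∞) :
    Summable fun φ : Φ => ‖hat ((φ : L2Rn n) i) ξ‖ ^ 2 := by
  simpa only [ENNReal.toReal_pow, toReal_enorm, hat] using ENNReal.summable_toReal h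

end Generator

section GMRA

variable {n N : ℕ} {hN : 2 ≤ N} {σ : Equiv.Perm (Fin n)} {z : Fin n → Circle}
  {V : ℤ → Submodule ℂ (L2Rn n)}

theorem IsGMRA.U_mem (hV : IsGMRA N hN σ z V) {j : ℤ} {f : L2Rn n} (hf : f ∈ V j) :
    U N hN σ f ∈ V (j - 1) :=
  hV.map_U j ▸ Submodule.mem_map_of_mem hf

theorem IsGMRA.U_iterate_mem (hV : IsGMRA N hN σ z V) {j : ℤ} {f : L2Rn n} (hf : f ∈ V j)
    (k : ℕ) : (U N hN σ)^[k] f ∈ V (j - k) := by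
  induction k with
  | zero => simpa using hf
  | succ k ih =>
    rw [Function.iterate_succ_apply', Nat.cast_add_one, ← sub_sub]
    exact hV.U_mem ih

theorem IsGMRA.dense_setOf_U_iterate_mem (hV : IsGMRA N hN σ z V) :
    Dense {f | ∃ j : ℕ, (U N hN σ)^[j] f ∈ V 0} := by
  refine hV.dense_iUnion.mono (Set.iUnion_subset fun j f hf => ⟨j.toNat, ?_⟩)
  exact monotone_int_of_le_succ hV.le_succ (sub_nonpos.2 j.self_le_toNat) (hV.U_iterate_mem hf _)

end GMRA

end SuperWavelet

end

open SuperWavelet in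
theorem mainTheorem11_general {n : ℕ} {c : ℝ} (hc : 1 < c) (σ : Equiv.Perm (Fin n))
    (z : Fin n → Circle) (W : Submodule ℂ (L2Rn n))
    (hW : ∀ f ∈ W, permDilation (one_pos.trans hc) σ f ∈ W)
    (hdense : Dense {f | ∃ j : ℕ, (permDilation (one_pos.trans hc) σ)^[j] f ∈ W})
    (Φ : Set (L2Rn n)) (hΦ : IsNTFGenerator z Φ W) :
    ∀ᵐ ξ : ℝ, ∀ i : Fin n,
      (∀ m : ℕ, Summable fun φ : Φ => ‖hat ((φ : L2Rn n) i) (ξ / c ^ m)‖ ^ 2) ∧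
      Tendsto (fun m : ℕ => ∑' φ : Φ, ‖hat ((φ : L2Rn n) i) (ξ / c ^ m)‖ ^ 2) atTop (𝓝 1) := by
  have hrescale := quasiMP_div Real.two_pi_pos
  have hbound : ∀ᵐ ξ : ℝ, ∀ i (m : ℕ), localTrace Φ i (ξ / c ^ m / (2 * Real.pi)) ≤ 1 :=
    ae_all_iff.2 fun i => ae_all_iff.2 fun m =>
      (quasiMP_div (pow_pos (one_pos.trans hc) m)).ae (hrescale.ae (ae_localTrace_le_one hΦ i))
  filter_upwards [hbound, hrescale.ae (ae_tendsto_localTrace hc hΦ hW hdense)] with ξ hle hlim i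
  refine ⟨fun m => summable_norm_hat_sq (ne_top_of_le_ne_top ENNReal.one_ne_top (hle i m)), ?_⟩
  simp only [div_right_comm ξ (2 * Real.pi)] at hlim
  simp only [← toReal_localTrace_div_two_pi]
  exact (ENNReal.tendsto_toReal ENNReal.one_ne_top).comp (hlim i)

theorem mainTheorem11 (n N : ℕ) (hN : 2 ≤ N) (σ : Equiv.Perm (Fin n)) (z : Fin n → Circle)
    (hz : ∀ i, z i ^ N = z (σ i))
    (V : ℤ → Submodule ℂ (SuperWavelet.L2Rn n)) (hV : SuperWavelet.IsGMRA N hN σ z V)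
    (Φ : Set (SuperWavelet.L2Rn n)) (hΦ : SuperWavelet.IsNTFGenerator z Φ (V 0)) :
    ∀ᵐ ξ : ℝ, ∀ i : Fin n,
      (∀ m : ℕ, Summable fun φ : Φ =>
        ‖SuperWavelet.hat ((φ : SuperWavelet.L2Rn n) i) (ξ / (N : ℝ) ^ m)‖ ^ 2) ∧
      Tendsto (fun m : ℕ => ∑' φ : Φ,
        ‖SuperWavelet.hat ((φ : SuperWavelet.L2Rn n) i) (ξ / (N : ℝ) ^ m)‖ ^ 2)
        atTop (𝓝 1) := by
  exact mainTheorem11_general (Nat.one_lt_cast.2 hN) σ z (V 0)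
    (fun f hf => hV.le_succ (-1) (hV.U_mem hf)) hV.dense_setOf_U_iterate_mem Φ hΦ
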